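/- All rings are commutative with identity, and a local ring is a ring with exactly one maximal ideal (not necessarily Noetherian). An ideal is *regular* if it contains a nonzerodivisor. A *generalized local ring* is a local ring whose maximal ideal $M$ is finitely generated and satisfies $\bigcap_{i>0} M^i = 0$. For an ideal $I$ of a ring $A$ with total quotient ring $Q(A)$, the *Nagata transform* of $I$ is the ring $T(I)=\bigcup_{k>0}\{q\in Q(A) : qI^k\subseteq A\}$. A ring is *semilocal* if it has only finitely many maximal ideals. **Theorem.** Let $R$ be a local ring. The maximal ideal of $R$ is finitely generated, regular and the radical of a principal ideal if and only if $R$ occurs (up to isomorphism) in a pullback diagram $$\begin{array}{ccc} R=\beta^{-1}(A) & \longrightarrow & A\\ \downarrow & & \downarrow{\scriptstyle\iota}\\ T & \stackrel{\beta}{\longrightarrow} & B\end{array}$$ where $A$, $B$ and $T$ are rings such that (a) $\beta:T\to B$ is a surjective ring homomorphism, $A$ is a subring of $B$ and $\iota:A\to B$ is the inclusion map; (b) $A$ is a generalized local ring whose maximal ideal is regular and is the radical of a principal ideal; (c) $B$ is (isomorphic, as an $A$-algebra, to) the Nagata transform of the maximal ideal of $A$. Moreover, in every such diagram the ring $T$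 is semilocal. -/

import Mathlib

open scoped nonZeroDivisors

universe u v w

/-- An ideal of a commutative ring is regular if it contains a nonzerodivisor. -/
def IsRegularIdeal {R : Type*} [CommRing R] (I : Ideal R) : Prop :=
  ∃ x ∈ I, x ∈ R⁰

/-- The ideal `I` is the radical of a principal ideal. -/
def IsRadicalOfPrincipal {R : Type*} [CommRing R] (I : Ideal R) : Prop :=
  ∃ m : R, I = (Ideal.span {m}).radical

/-- A generalized local ring: a (not necessarily Noetherian) local ring with maximal ideal `M`
such that `M` is finitely generated and `⋂_{i > 0} M ^ i = 0`. -/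
class IsGeneralizedLocalRing (R : Type*) [CommRing R] : Prop extends IsLocalRing R where
  fg_maximalIdeal : (IsLocalRing.maximalIdeal R).FG
  iInf_pow_eq_bot : ⨅ i : ℕ, ⨅ _ : 0 < i, IsLocalRing.maximalIdeal R ^ i = ⊥

/-- A ring is semilocal if it has only finitely many maximal ideals. -/
def IsSemilocalRing (R : Type*) [CommRing R] : Prop :=
  Finite (MaximalSpectrum R)

/-- `(R :_{Q(R)} J)`, for an ideal `J` of `R`, as a subset of the total quotient ring `Q(R)`
(which is `FractionRing R`). -/
def colonInFractionRing {R : Type*} [CommRing R] (J : Ideal R) : Set (FractionRing R) :=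
  {q | ∀ x ∈ J, q * algebraMap R (FractionRing R) x ∈ (algebraMap R (FractionRing R)).range}

theorem colonInFractionRing_anti {R : Type*} [CommRing R] {J K : Ideal R} (h : J ≤ K) :
    colonInFractionRing K ⊆ colonInFractionRing J :=
  fun _ hq x hx => hq x (h hx)

theorem mul_mem_colonInFractionRing {R : Type*} [CommRing R] {J K : Ideal R}
    {p q : FractionRing R} (hp : p ∈ colonInFractionRing J) (hq : q ∈ colonInFractionRing K) :
    p * q ∈ colonInFractionRing (J * K) := by
  intro x hx
  induction hx using Submodule.mul_induction_on' with
  | mem_mul_mem a ha b hb =>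
    have h := mul_mem (hp a ha) (hq b hb)
    rw [map_mul]
    convert h using 1
    ring
  | add a _ b _ ha hb =>
    rw [map_add, mul_add]
    exact add_mem ha hb

/-- The Nagata transform `T(I) = ⋃_{k > 0} (R :_{Q(R)} I ^ k)` of an ideal `I` of `R`, an
`R`-subalgebra of the total quotient ring `Q(R)`. -/
def nagataTransform {R : Type*} [CommRing R] (I : Ideal R) : Subalgebra R (FractionRing R) where
  carrier := ⋃ k : ℕ, ⋃ _ : 0 < k, colonInFractionRing (I ^ k)
  mul_mem' := by
    intro p q hp hq
    simp only [Set.mem_iUnion, exists_prop] at hp hq ⊢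
    obtain ⟨k, hk, hp⟩ := hp
    obtain ⟨l, hl, hq⟩ := hq
    exact ⟨k + l, by omega, by rw [pow_add]; exact mul_mem_colonInFractionRing hp hq⟩
  add_mem' := by
    intro p q hp hq
    simp only [Set.mem_iUnion, exists_prop] at hp hq ⊢
    obtain ⟨k, hk, hp⟩ := hp
    obtain ⟨l, hl, hq⟩ := hq
    refine ⟨k + l, by omega, fun x hx => ?_⟩
    rw [add_mul]
    exact add_mem (colonInFractionRing_anti (Ideal.pow_le_pow_right (by omega)) hp x hx)
      (colonInFractionRing_anti (Ideal.pow_le_pow_right (by omega)) hq x hx)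
  algebraMap_mem' := by
    intro r
    simp only [Set.mem_iUnion, exists_prop]
    exact ⟨1, one_pos, fun x _ => ⟨r * x, map_mul _ _ _⟩⟩

/-- `R` occurs in the pullback diagram `R = β⁻¹(A)` of the surjection `β : T → B` along the
inclusion of the subring `A ⊆ B`, where `A` is a generalized local ring with regular maximal ideal
that is the radical of a principal ideal, and `B` is (as an extension ring of `A`) the Nagata
transform of the maximal ideal of `A`. The map `j : R → T` is the left-hand arrow of the diagram;
it identifies `R` with `β⁻¹(A)`. -/
structure IsGLRPullback {R T B : Type*} [CommRing R] [CommRing T] [CommRing B]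
    (j : R →+* T) (β : T →+* B) (A : Subring B) : Prop where
  injective_left : Function.Injective j
  range_left : j.range = A.comap β
  surjective : Function.Surjective β
  generalizedLocal : IsGeneralizedLocalRing A
  regular : IsRegularIdeal (IsLocalRing.maximalIdeal A)
  radical : IsRadicalOfPrincipal (IsLocalRing.maximalIdeal A)
  nagata : Nonempty (B ≃ₐ[A] nagataTransform (IsLocalRing.maximalIdeal A))

/-!
Both directions compare inverting `m` in `R`, where `m` generates the maximal ideal up to radical,
with inverting its image in `A`. If a finitely generated regular ideal is the radical of `(a)`, then
its Nagata transform is `A[1/a]`, so `B` is always a localization of `A` away from one element.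

* Given `R`, put `T = R[1/m]`. The ideal `P = ⋂ mⁱR = ⋂ Mⁱ` satisfies `P = mP`, hence is an ideal of
  `T` as well, and `R` is the preimage of `A = R/P` under `T → B = T/P = A[1/m]`.
* Given a square, `ker β` lies in `R`, so a lift `m` of the generator `a` is a unit of `T` and
  `ker β = m ker β ⊆ mR`. Thus the properties of `A` lift to `R`, and `T = R[1/m]`.
* `T` is semilocal: as `R/(m)` is Artinian, some finite intersection `K` of maximal ideals of `T`
  has a trace on `R` that is minimal modulo `m`. If `Q` is maximal, then
  `K ∩ R ⊆ (Q ∩ K ∩ R) + m(K ∩ R)`, which forces `K ⊆ Q` since `m` is in the Jacobson radical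
  of `R`; so `Q` is one of the finitely many maximal ideals defining `K`.
-/

open IsLocalRing

section Ideals

variable {R A : Type*} [CommRing R] [CommRing A]

theorem IsRegularIdeal.mem_nonZeroDivisors {I : Ideal R} (hI : IsRegularIdeal I) {a : R}
    (h : I ≤ (Ideal.span {a}).radical) : a ∈ R⁰ := by
  obtain ⟨x, hxI, hx⟩ := hI
  obtain ⟨n, hn⟩ := h hxI
  obtain ⟨c, hc⟩ := Ideal.mem_span_singleton'.mp hn
  have hca : c * a ∈ R⁰ := hc ▸ pow_mem hx n
  exact (mul_mem_nonZeroDivisors.mp hca).2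

theorem iInf_pos_pow_eq_iInf_pow (I : Ideal R) :
    ⨅ i : ℕ, ⨅ _ : 0 < i, I ^ i = ⨅ i : ℕ, I ^ i :=
  le_antisymm
    (le_iInf fun i => (iInf₂_le (i + 1) i.succ_pos).trans (Ideal.pow_le_pow_right i.le_succ))
    (le_iInf₂ fun i _ => iInf_le _ i)

theorem iInf_pow_eq_of_pow_le {I J : Ideal R} (hJI : J ≤ I) {k : ℕ} (hIJ : I ^ k ≤ J) :
    ⨅ i : ℕ, I ^ i = ⨅ i : ℕ, J ^ i :=
  le_antisymm
    (le_iInf fun i => (iInf_le _ (k * i)).trans (pow_mul I k i ▸ Ideal.pow_right_mono hIJ i))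
    (iInf_mono fun i => Ideal.pow_right_mono hJI i)

theorem iInf_map_pow_eq_bot {f : R →+* A} (hf : Function.Surjective f) {I : Ideal R}
    (hker : RingHom.ker f = ⨅ i : ℕ, I ^ i) : ⨅ i : ℕ, I.map f ^ i = ⊥ := by
  have hcomap (i : ℕ) : (I.map f ^ i).comap f = I ^ i := by
    rw [← Ideal.map_pow, Ideal.comap_map_of_surjective' f hf, hker]
    exact sup_eq_left.mpr (iInf_le _ i)
  apply Ideal.comap_injective_of_surjective f hf
  rw [Ideal.comap_iInf, ← RingHom.ker_eq_comap_bot, hker]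
  exact iInf_congr hcomap

theorem fg_comap_of_surjective {f : R →+* A} (hf : Function.Surjective f) {I : Ideal A}
    (hI : I.FG) {J : Ideal R} (hJ : J.FG) (hker : RingHom.ker f ≤ J) (hJI : J ≤ I.comap f) :
    (I.comap f).FG := by
  classical
  obtain ⟨s, rfl⟩ := hI
  obtain ⟨t, rfl⟩ : ∃ t : Finset R, t.image f = s := by
    obtain ⟨t, -, ht⟩ := Finset.subset_set_image_iff.mp
      (show (s : Set A) ⊆ f '' Set.univ by simp [hf.range_eq])
    exact ⟨t, ht⟩
  have hcomap : (Ideal.span (t.image f : Set A)).comap f = Ideal.span t ⊔ RingHom.ker f := by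
    rw [Finset.coe_image, ← Ideal.map_span, Ideal.comap_map_of_surjective' f hf]
  have hsup : (Ideal.span (t.image f : Set A)).comap f = Ideal.span t ⊔ J :=
    le_antisymm (hcomap.trans_le (sup_le_sup_left hker _))
      (sup_le (le_sup_left.trans hcomap.ge) hJI)
  exact hsup ▸ Submodule.FG.sup ⟨t, rfl⟩ hJ

theorem maximalIdeal_eq_radical_iff_of_surjective [IsLocalRing R] [IsLocalRing A] {f : R →+* A}
    (hf : Function.Surjective f) {m : R} (hker : RingHom.ker f ≤ Ideal.span {m}) :
    maximalIdeal A = (Ideal.span {f m}).radical ↔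
      maximalIdeal R = (Ideal.span {m}).radical := by
  have := hf.isLocalHom
  have hspan : (Ideal.span {f m}).comap f = Ideal.span {m} := by
    rw [← Set.image_singleton, ← Ideal.map_span, Ideal.comap_map_of_surjective' f hf]
    exact sup_eq_left.mpr hker
  rw [← (Ideal.comap_injective_of_surjective f hf).eq_iff, maximalIdeal_comap,
    Ideal.comap_radical, hspan]

theorem isGeneralizedLocalRing_of_surjective [IsLocalRing R] {f : R →+* A}
    (hf : Function.Surjective f) (hfg : (maximalIdeal R).FG)
    (hker : RingHom.ker f = ⨅ i : ℕ, maximalIdeal R ^ i) : IsGeneralizedLocalRing A := by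
  have hker_le : RingHom.ker f ≤ maximalIdeal R :=
    hker.trans_le ((iInf_le _ 1).trans_eq (pow_one _))
  have : Nontrivial A :=
    nontrivial_of_ne (f 1) 0 fun h => one_notMem_nonunits (hker_le h)
  have : IsLocalRing A := .of_surjective' f hf
  have hmap := map_maximalIdeal_of_surjective f hf
  exact
    { fg_maximalIdeal := hmap ▸ hfg.map f
      iInf_pow_eq_bot := by
        rw [iInf_pos_pow_eq_iInf_pow, ← hmap, iInf_map_pow_eq_bot hf hker] }

end Ideals

section NagataTransform

variable {R : Type*} [CommRing R] {I : Ideal R}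

theorem mem_nagataTransform {q : FractionRing R} :
    q ∈ nagataTransform I ↔ ∃ k > 0, q ∈ colonInFractionRing (I ^ k) :=
  Set.mem_iUnion₂.trans (by simp only [exists_prop, gt_iff_lt])

theorem isLocalization_away_nagataTransform {a : R} (ha : a ∈ R⁰) (haI : a ∈ I) {k : ℕ}
    (hk : I ^ k ≤ Ideal.span {a}) : IsLocalization.Away a (nagataTransform I) := by
  have hinj : Function.Injective (algebraMap R (nagataTransform I)) := fun x y h =>
    IsFractionRing.injective R (FractionRing R) (congrArg Subtype.val h)
  refine .mk a ?_ ?_ fun x y h => ⟨0, by rw [hinj h]⟩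
  · obtain ⟨b, hb⟩ := (IsLocalization.map_units (FractionRing R) ⟨a, ha⟩).exists_right_inv
    have hbI : b ∈ nagataTransform I := by
      refine mem_nagataTransform.mpr ⟨k + 1, k.succ_pos, fun x hx => ?_⟩
      obtain ⟨c, rfl⟩ := Ideal.mem_span_singleton'.mp (hk (Ideal.pow_le_pow_right k.le_succ hx))
      exact ⟨c, by rw [map_mul, mul_left_comm, mul_comm b, hb, mul_one]⟩
    exact .of_mul_eq_one (⟨b, hbI⟩ : nagataTransform I) (Subtype.ext hb)
  · rintro ⟨q, hq⟩
    obtain ⟨n, -, hn⟩ := mem_nagataTransform.mp hq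
    obtain ⟨r, hr⟩ := hn (a ^ n) (Ideal.pow_mem_pow haI n)
    exact ⟨n, r, Subtype.ext (by simpa using hr.symm)⟩

theorem isLocalization_away_iff_nonempty_algEquiv_nagataTransform {B : Type*} [CommRing B]
    [Algebra R B] {a : R} (hreg : IsRegularIdeal I) (hfg : I.FG)
    (hI : I = (Ideal.span {a}).radical) :
    IsLocalization.Away a B ↔ Nonempty (B ≃ₐ[R] nagataTransform I) := by
  obtain ⟨k, hk⟩ := Ideal.exists_pow_le_of_le_radical_of_fg hI.le hfg
  have := isLocalization_away_nagataTransform (hreg.mem_nonZeroDivisors hI.le)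
    (hI ▸ Ideal.le_radical (Ideal.mem_span_singleton_self a)) hk
  exact ⟨fun _ => ⟨IsLocalization.algEquiv (.powers a) _ _⟩,
    fun ⟨φ⟩ => IsLocalization.isLocalization_of_algEquiv (.powers a) φ.symm⟩

end NagataTransform

section Semilocal

variable {R T : Type*} [CommRing R] [CommRing T] [Algebra R T] {m : R}

theorem isArtinianRing_quotient_of_isMaximal_radical {J : Ideal R} (hmax : J.radical.IsMaximal)
    (hfg : J.radical.FG) : IsArtinianRing (R ⧸ J) := by
  have hq := Ideal.Quotient.mk_surjective (I := J)
  have hcomap (P : Ideal (R ⧸ J)) (hP : P.IsPrime) :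
      P.comap (Ideal.Quotient.mk J) = J.radical := by
    refine (hmax.eq_of_le (Ideal.comap_ne_top _ hP.ne_top) ?_).symm
    rw [(Ideal.comap_isPrime _ P).radical_le_iff, ← Ideal.map_le_iff_le_comap,
      Ideal.map_quotient_self]
    exact bot_le
  refine isArtinianRing_iff_isNoetherianRing_krullDimLE_zero.mpr
    ⟨.of_prime fun P hP => ?_, Ring.krullDimLE_zero_iff.mpr fun P hP => ?_⟩
  · rw [← Ideal.map_comap_of_surjective _ hq P, hcomap P hP]
    exact hfg.map _
  · have := Ideal.map_eq_top_or_isMaximal_of_surjective _ hq (hcomap P hP ▸ hmax)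
    rw [Ideal.map_comap_of_surjective _ hq] at this
    exact this.resolve_left hP.ne_top

theorem le_sup_pow_mul_of_le_sup_mul {I J P : Ideal R} (h : J ≤ P ⊔ I * J) (k : ℕ) :
    J ≤ P ⊔ I ^ k * J := by
  induction k with
  | zero => simp only [pow_zero, one_mul, le_sup_right]
  | succ k ih =>
    calc
      J ≤ P ⊔ I * (P ⊔ I ^ k * J) := h.trans (sup_le_sup_left (Ideal.mul_mono_right ih) P)
      _ = P ⊔ I * P ⊔ I ^ (k + 1) * J := by
        rw [Ideal.mul_sup, ← mul_assoc, ← pow_succ', ← sup_assoc]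
      _ = P ⊔ I ^ (k + 1) * J := by
        rw [sup_eq_left.mpr (Ideal.mul_le_right : I * P ≤ P)]

/- `J` need not be finitely generated, so Nakayama's lemma is not available: what replaces it is
that the image of `J` in the field `T / Q = (R / Q ∩ R)[1 / m]` generates the unit ideal. -/
theorem le_under_of_le_under_sup_span_mul [IsLocalization.Away m T]
    (hm : m ∈ (⊥ : Ideal R).jacobson) {Q : Ideal T} (hQ : Q.IsMaximal) {J : Ideal R}
    (h : J ≤ Q.under R ⊔ Ideal.span {m} * J) : J ≤ Q.under R := by
  by_contra hJ
  obtain ⟨x, hxJ, hxQ⟩ := SetLike.not_le_iff_exists.mp hJ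
  obtain ⟨t, q, hqQ, htq⟩ := hQ.exists_inv hxQ
  obtain ⟨s, r, hr⟩ := IsLocalization.Away.surj m t
  have hsub : r * x - m ^ s ∈ Q.under R := by
    rw [Ideal.mem_under, map_sub, map_mul, map_pow, ← hr]
    convert neg_mem (Q.mul_mem_left (algebraMap R T m ^ s) hqQ) using 1
    linear_combination algebraMap R T m ^ s * htq
  have hpow : m ^ s ∈ Q.under R ⊔ Ideal.span {m} ^ (s + 1) := by
    have hle : J ≤ Q.under R ⊔ Ideal.span {m} ^ (s + 1) :=
      (le_sup_pow_mul_of_le_sup_mul h (s + 1)).trans (sup_le_sup_left Ideal.mul_le_left _)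
    simpa using sub_mem (hle (J.mul_mem_left r hxJ)) (Ideal.mem_sup_left hsub)
  obtain ⟨p, hp, d, hd, hpd⟩ := Submodule.mem_sup.mp hpow
  rw [Ideal.span_singleton_pow] at hd
  obtain ⟨b, rfl⟩ := Ideal.mem_span_singleton.mp hd
  have hunit : IsUnit (m * -b + 1) := Ideal.mem_jacobson_bot.mp hm (-b)
  have hp_eq : p = m ^ s * (m * -b + 1) := by linear_combination hpd
  rw [Ideal.mem_under, hp_eq, map_mul, map_pow] at hp
  exact hQ.ne_top <| Q.eq_top_of_isUnit_mem hp <|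
    (IsLocalization.Away.algebraMap_pow_isUnit m s).mul (hunit.map _)

theorem under_inf_span_le_span_mul_under (hm : IsUnit (algebraMap R T m)) (K : Ideal T) :
    K.under R ⊓ Ideal.span {m} ≤ Ideal.span {m} * K.under R := by
  rintro x ⟨hxK, hxm⟩
  obtain ⟨b, rfl⟩ := Ideal.mem_span_singleton.mp hxm
  have hb : b ∈ K.under R := by
    rwa [SetLike.mem_coe, Ideal.mem_under, map_mul, Ideal.unit_mul_mem_iff_mem K hm] at hxK
  exact Ideal.mul_mem_mul (Ideal.mem_span_singleton_self m) hb

theorem isSemilocalRing_of_away [IsLocalization.Away m T] (hm : m ∈ (⊥ : Ideal R).jacobson)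
    [IsArtinianRing (R ⧸ Ideal.span {m})] : IsSemilocalRing T := by
  classical
  let contraction (s : Finset (MaximalSpectrum T)) : Ideal R :=
    (s.inf MaximalSpectrum.asIdeal).under R
  let reduction (s : Finset (MaximalSpectrum T)) : Ideal (R ⧸ Ideal.span {m}) :=
    (contraction s).map (Ideal.Quotient.mk _)
  obtain ⟨_, ⟨s, rfl⟩, hs⟩ :=
    IsArtinian.set_has_minimal (Set.range reduction) (Set.range_nonempty _)
  suffices ∀ Q : MaximalSpectrum T, Q ∈ s from @Finite.of_fintype _ ⟨s, this⟩
  intro Q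
  have hanti : contraction (insert Q s) ≤ contraction s :=
    Ideal.comap_mono (Finset.inf_mono (Finset.subset_insert Q s))
  have hstable : reduction (insert Q s) = reduction s :=
    (Ideal.map_mono hanti).eq_of_not_lt (hs _ ⟨_, rfl⟩)
  have hle_sup : contraction s ≤ contraction (insert Q s) ⊔ Ideal.span {m} := by
    have h : contraction s ≤ (reduction (insert Q s)).comap (Ideal.Quotient.mk _) :=
      Ideal.map_le_iff_le_comap.mp hstable.ge
    rwa [Ideal.comap_map_of_surjective' _ Ideal.Quotient.mk_surjective, Ideal.mk_ker] at h
  have hle_mul : contraction s ≤ Q.asIdeal.under R ⊔ Ideal.span {m} * contraction s :=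
    calc
      contraction s ≤ (contraction (insert Q s) ⊔ Ideal.span {m}) ⊓ contraction s :=
        le_inf hle_sup le_rfl
      _ = contraction (insert Q s) ⊔ contraction s ⊓ Ideal.span {m} := by
        rw [sup_inf_assoc_of_le _ hanti, inf_comm]
      _ ≤ Q.asIdeal.under R ⊔ Ideal.span {m} * contraction s :=
        sup_le_sup (Ideal.comap_mono (Finset.inf_le (Finset.mem_insert_self Q s)))
          (under_inf_span_le_span_mul_under (IsLocalization.Away.algebraMap_isUnit m) _)
  have hle : s.inf MaximalSpectrum.asIdeal ≤ Q.asIdeal := by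
    rw [← IsLocalization.map_under (.powers m) T (s.inf _), Ideal.map_le_iff_le_comap]
    exact le_under_of_le_under_sup_span_mul hm Q.isMaximal hle_mul
  obtain ⟨P, hPs, hPQ⟩ := Q.isMaximal.isPrime.inf_le'.mp hle
  rwa [← MaximalSpectrum.ext (P.isMaximal.eq_of_le Q.isMaximal.ne_top hPQ)]

end Semilocal

section InfinitelyDivisible

variable {R T : Type*} [CommRing R] [CommRing T] [Algebra R T] {m : R}

/-- The ideal of the elements of `R` that are divisible by every power of `m`. When `m` is a
nonzerodivisor, it is a common ideal of `R` and `R[1/m]`, along which the square of `IsGLRPullback`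
is formed. -/
def infinitelyDivisible (m : R) : Ideal R :=
  ⨅ i : ℕ, Ideal.span {m} ^ i

theorem mem_infinitelyDivisible {x : R} : x ∈ infinitelyDivisible m ↔ ∀ i : ℕ, m ^ i ∣ x := by
  simp only [infinitelyDivisible, Submodule.mem_iInf, Ideal.span_singleton_pow,
    Ideal.mem_span_singleton]

theorem infinitelyDivisible_eq_iInf_pow {I : Ideal R} (hfg : I.FG)
    (hI : I = (Ideal.span {m}).radical) : infinitelyDivisible m = ⨅ i : ℕ, I ^ i := by
  obtain ⟨k, hk⟩ := Ideal.exists_pow_le_of_le_radical_of_fg hI.le hfg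
  exact (iInf_pow_eq_of_pow_le (hI ▸ Ideal.le_radical) hk).symm

theorem mem_infinitelyDivisible_of_pow_mul_mem (hm : m ∈ R⁰) {k : ℕ} {x : R}
    (h : m ^ k * x ∈ infinitelyDivisible m) : x ∈ infinitelyDivisible m := by
  refine mem_infinitelyDivisible.mpr fun i => ?_
  obtain ⟨c, hc⟩ := mem_infinitelyDivisible.mp h (k + i)
  rw [pow_add, mul_assoc] at hc
  exact ⟨c, (mul_cancel_left_mem_nonZeroDivisors (pow_mem hm k)).mp hc⟩

theorem mem_map_infinitelyDivisible [IsLocalization.Away m T] (hm : m ∈ R⁰) {t : T} :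
    t ∈ (infinitelyDivisible m).map (algebraMap R T) ↔
      ∃ p ∈ infinitelyDivisible m, algebraMap R T p = t := by
  refine ⟨fun ht => ?_, fun ⟨p, hp, h⟩ => h ▸ Ideal.mem_map_of_mem _ hp⟩
  obtain ⟨⟨⟨p, hp⟩, ⟨_, k, rfl⟩⟩, h⟩ :=
    (IsLocalization.mem_map_algebraMap_iff (.powers m) T).mp ht
  obtain ⟨q, rfl⟩ := mem_infinitelyDivisible.mp hp k
  refine ⟨q, mem_infinitelyDivisible_of_pow_mul_mem hm hp, ?_⟩
  refine (IsLocalization.Away.algebraMap_pow_isUnit m k).mul_left_cancel ?_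
  simpa [mul_comm t] using h.symm

theorem comap_map_infinitelyDivisible [IsLocalization.Away m T] (hm : m ∈ R⁰) :
    ((infinitelyDivisible m).map (algebraMap R T)).comap (algebraMap R T) =
      infinitelyDivisible m := by
  refine le_antisymm (fun x hx => ?_) Ideal.le_comap_map
  obtain ⟨p, hp, hpx⟩ := (mem_map_infinitelyDivisible hm).mp hx
  exact IsLocalization.injective T (Submonoid.powers_le.mpr hm) hpx ▸ hp

end InfinitelyDivisible

section Square

variable {R T A B : Type*} [CommRing R] [CommRing T] [CommRing A] [CommRing B] [Algebra R T]
  {β : T →+* B} {m : R}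

theorem isLocalHom_of_ker_le_range [IsLocalRing R] [Nontrivial B] (hβ : Function.Surjective β)
    (hker : ∀ t ∈ RingHom.ker β, t ∈ (algebraMap R T).range) : IsLocalHom β := by
  refine ⟨fun t ht => ?_⟩
  obtain ⟨b, hb⟩ := ht.exists_right_inv
  obtain ⟨s, rfl⟩ := hβ b
  have hβ0 : β (1 - t * s) = 0 := by rw [map_sub, map_mul, hb, map_one, sub_self]
  obtain ⟨r, hr⟩ := hker _ hβ0
  rcases isUnit_or_isUnit_one_sub_self r with h | h
  · exact absurd ((h.map (algebraMap R T)).map β) (by rw [hr, hβ0]; exact not_isUnit_zero)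
  · refine isUnit_of_mul_isUnit_left (y := s) ?_
    simpa [hr] using h.map (algebraMap R T)

theorem ker_comp_algebraMap_le_span_singleton (hinj : Function.Injective (algebraMap R T))
    (hm : IsUnit (algebraMap R T m)) (hker : ∀ t ∈ RingHom.ker β, t ∈ (algebraMap R T).range) :
    RingHom.ker (β.comp (algebraMap R T)) ≤ Ideal.span {m} := by
  intro x hx
  obtain ⟨u, hu⟩ := hm.exists_right_inv
  obtain ⟨y, hy⟩ := hker (u * algebraMap R T x) (Ideal.mul_mem_left _ _ hx)
  refine Ideal.mem_span_singleton'.mpr ⟨y, hinj ?_⟩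
  rw [map_mul, hy]
  linear_combination algebraMap R T x * hu

variable [Algebra A B] {f : R →+* A}

theorem isLocalization_away_of_isLocalization_away_map (hinj : Function.Injective (algebraMap R T))
    (hm : IsUnit (algebraMap R T m)) (hker : ∀ t ∈ RingHom.ker β, t ∈ (algebraMap R T).range)
    (hf : Function.Surjective f) (hcomm : ∀ r, β (algebraMap R T r) = algebraMap A B (f r))
    [IsLocalization.Away (f m) B] : IsLocalization.Away m T := by
  refine .mk m hm (fun t => ?_) fun x y h => ⟨0, by rw [hinj h]⟩
  obtain ⟨n, a, ha⟩ := IsLocalization.Away.surj (f m) (β t)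
  obtain ⟨r, rfl⟩ := hf a
  obtain ⟨p, hp⟩ := hker (t * algebraMap R T m ^ n - algebraMap R T r) <| by
    rw [RingHom.mem_ker, map_sub, map_mul, map_pow, hcomm, hcomm, ha, sub_self]
  exact ⟨n, p + r, by rw [map_add, hp, sub_add_cancel]⟩

theorem isLocalization_away_map (hβ : Function.Surjective β)
    (hinj : Function.Injective (algebraMap A B))
    (hcomm : ∀ r, β (algebraMap R T r) = algebraMap A B (f r)) [IsLocalization.Away m T] :
    IsLocalization.Away (f m) B := by
  refine .mk (f m) ?_ (fun b => ?_) fun x y h => ⟨0, by rw [hinj h]⟩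
  · exact hcomm m ▸ (IsLocalization.Away.algebraMap_isUnit m).map β
  · obtain ⟨t, rfl⟩ := hβ b
    obtain ⟨n, r, hr⟩ := IsLocalization.Away.surj m t
    exact ⟨n, f r, by rw [← hcomm, ← hcomm, ← hr, map_mul, map_pow]⟩

end Square

/-- The pullback square of `IsGLRPullback` with `A` only a local ring with finitely generated
maximal ideal: the powers of that ideal need not intersect in `0`. The properties of `R` and `T` can
already be recovered from such a square. -/
structure IsLocalNagataPullback {R T B : Type*} [CommRing R] [CommRing T] [CommRing B]
    (j : R →+* T) (β : T →+* B) (A : Subring B) : Prop where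
  injective_left : Function.Injective j
  range_left : j.range = A.comap β
  surjective : Function.Surjective β
  isLocalRing : IsLocalRing A
  fg : (maximalIdeal A).FG
  regular : IsRegularIdeal (maximalIdeal A)
  radical : IsRadicalOfPrincipal (maximalIdeal A)
  nagata : Nonempty (B ≃ₐ[A] nagataTransform (maximalIdeal A))

section Pullback

variable {R T B : Type*} [CommRing R] [CommRing T] [CommRing B]

theorem IsGLRPullback.isLocalNagataPullback {j : R →+* T} {β : T →+* B} {A : Subring B}
    (h : IsGLRPullback j β A) : IsLocalNagataPullback j β A :=
  { h with
    isLocalRing := h.generalizedLocal.toIsLocalRing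
    fg := h.generalizedLocal.fg_maximalIdeal }

namespace IsLocalNagataPullback

theorem eq_range {j : R →+* T} {β : T →+* B} {A : Subring B} (h : IsLocalNagataPullback j β A) :
    A = (β.comp j).range := by
  rw [← RingHom.map_range, h.range_left, Subring.map_comap_eq_self_of_surjective h.surjective]

theorem mem_range_of_mem_ker {j : R →+* T} {β : T →+* B} {A : Subring B}
    (h : IsLocalNagataPullback j β A) {t : T} (ht : t ∈ RingHom.ker β) : t ∈ j.range := by
  rw [h.range_left, Subring.mem_comap, ht]
  exact A.zero_mem

theorem exists_away [IsLocalRing R] [Algebra R T] {β : T →+* B} {A : Subring B}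
    (h : IsLocalNagataPullback (algebraMap R T) β A) :
    ∃ m : R, (maximalIdeal R).FG ∧ maximalIdeal R = (Ideal.span {m}).radical ∧
      IsLocalization.Away m T := by
  obtain rfl := h.eq_range
  have := h.isLocalRing
  let f := (β.comp (algebraMap R T)).rangeRestrict
  have hf : Function.Surjective f := RingHom.rangeRestrict_surjective _
  have hβker : ∀ t ∈ RingHom.ker β, t ∈ (algebraMap R T).range := fun _ => h.mem_range_of_mem_ker
  obtain ⟨a, ha⟩ := h.radical
  obtain ⟨m, rfl⟩ := hf a
  have hB : IsLocalization.Away (f m) B :=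
    (isLocalization_away_iff_nonempty_algEquiv_nagataTransform h.regular h.fg ha).mpr h.nagata
  have hm : IsUnit (algebraMap R T m) := by
    have : Nontrivial B := (β.comp (algebraMap R T)).range.subtype_injective.nontrivial
    have := isLocalHom_of_ker_le_range h.surjective hβker
    exact isUnit_of_map_unit β _ (IsLocalization.Away.algebraMap_isUnit (S := B) (f m))
  have hker : RingHom.ker f ≤ Ideal.span {m} :=
    (RingHom.ker_rangeRestrict _).trans_le
      (ker_comp_algebraMap_le_span_singleton h.injective_left hm hβker)
  have hrad := (maximalIdeal_eq_radical_iff_of_surjective hf hker).mp ha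
  have hfg : (maximalIdeal R).FG := by
    have := hf.isLocalHom
    rw [← maximalIdeal_comap f]
    refine fg_comap_of_surjective hf h.fg (Submodule.fg_span_singleton m) hker ?_
    rw [maximalIdeal_comap, hrad]
    exact Ideal.le_radical
  exact ⟨m, hfg, hrad, isLocalization_away_of_isLocalization_away_map h.injective_left hm hβker hf
    fun _ => rfl⟩

end IsLocalNagataPullback

theorem isGLRPullback_of_away [IsLocalRing R] [Algebra R T] {m : R} [IsLocalization.Away m T]
    (hfg : (maximalIdeal R).FG) (hrad : maximalIdeal R = (Ideal.span {m}).radical) (hm : m ∈ R⁰) :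
    let β := Ideal.Quotient.mk ((infinitelyDivisible m).map (algebraMap R T))
    IsGLRPullback (algebraMap R T) β (β.comp (algebraMap R T)).range := by
  intro β
  let f := (β.comp (algebraMap R T)).rangeRestrict
  have hf : Function.Surjective f := RingHom.rangeRestrict_surjective _
  have hβ : Function.Surjective β := Ideal.Quotient.mk_surjective
  have hker : RingHom.ker f = infinitelyDivisible m := by
    rw [RingHom.ker_rangeRestrict, ← RingHom.comap_ker, Ideal.mk_ker,
      comap_map_infinitelyDivisible hm]
  have hker_le : RingHom.ker f ≤ Ideal.span {m} :=
    hker.trans_le ((iInf_le _ 1).trans_eq (pow_one _))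
  have hA := isGeneralizedLocalRing_of_surjective hf hfg
    (hker.trans (infinitelyDivisible_eq_iInf_pow hfg hrad))
  have hArad := (maximalIdeal_eq_radical_iff_of_surjective hf hker_le).mpr hrad
  have hB : IsLocalization.Away (f m) (T ⧸ (infinitelyDivisible m).map (algebraMap R T)) :=
    isLocalization_away_map hβ Subtype.val_injective fun _ => rfl
  have hAreg : IsRegularIdeal (maximalIdeal (β.comp (algebraMap R T)).range) :=
    ⟨f m, hArad ▸ Ideal.le_radical (Ideal.mem_span_singleton_self _),
      mem_nonZeroDivisors_of_injective (Subring.subtype_injective _)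
        (IsLocalization.Away.algebraMap_isUnit (f m)).mem_nonZeroDivisors⟩
  exact
    { injective_left := IsLocalization.injective T (Submonoid.powers_le.mpr hm)
      range_left := by
        rw [← RingHom.map_range, Subring.comap_map_eq_self]
        intro t ht
        obtain ⟨p, -, hp⟩ :=
          (mem_map_infinitelyDivisible hm).mp (Ideal.Quotient.eq_zero_iff_mem.mp ht)
        exact ⟨p, hp⟩
      surjective := hβ
      generalizedLocal := hA
      regular := hAreg
      radical := ⟨f m, hArad⟩
      nagata :=
        (isLocalization_away_iff_nonempty_algEquiv_nagataTransform hAreg hA.fg_maximalIdeal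
          hArad).mp hB }

end Pullback

theorem mainTheorem4_general (R : Type u) [CommRing R] [IsLocalRing R] :
    (((maximalIdeal R).FG ∧ IsRegularIdeal (maximalIdeal R) ∧
        IsRadicalOfPrincipal (maximalIdeal R)) →
      ∃ (T B : Type u) (_ : CommRing T) (_ : CommRing B)
        (j : R →+* T) (β : T →+* B) (A : Subring B), IsGLRPullback j β A) ∧
    (∀ (T : Type v) (B : Type w) [CommRing T] [CommRing B]
        (j : R →+* T) (β : T →+* B) (A : Subring B), IsLocalNagataPullback j β A →
      ((maximalIdeal R).FG ∧ IsRegularIdeal (maximalIdeal R) ∧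
        IsRadicalOfPrincipal (maximalIdeal R)) ∧ IsSemilocalRing T) := by
  refine ⟨fun ⟨hfg, hreg, m, hrad⟩ => ?_, fun T B _ _ j β A h => ?_⟩
  · have := isGLRPullback_of_away (T := Localization.Away m) hfg hrad
      (hreg.mem_nonZeroDivisors hrad.le)
    exact ⟨_, _, _, _, _, _, _, this⟩
  · let := j.toAlgebra
    obtain ⟨m, hfg, hrad, hT⟩ := h.exists_away
    have hmM : m ∈ maximalIdeal R := hrad ▸ Ideal.le_radical (Ideal.mem_span_singleton_self m)
    have hm : m ∈ R⁰ := mem_nonZeroDivisors_of_injective h.injective_left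
      (IsLocalization.Away.algebraMap_isUnit (S := T) m).mem_nonZeroDivisors
    have : IsArtinianRing (R ⧸ Ideal.span {m}) :=
      isArtinianRing_quotient_of_isMaximal_radical (hrad ▸ maximalIdeal.isMaximal R) (hrad ▸ hfg)
    exact ⟨⟨hfg, ⟨m, hmM, hm⟩, m, hrad⟩,
      isSemilocalRing_of_away (maximalIdeal_le_jacobson ⊥ hmM)⟩

theorem mainTheorem4 (R : Type u) [CommRing R] [IsLocalRing R] :
    (((IsLocalRing.maximalIdeal R).FG ∧
        IsRegularIdeal (IsLocalRing.maximalIdeal R) ∧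
        IsRadicalOfPrincipal (IsLocalRing.maximalIdeal R)) ↔
      ∃ (T B : Type u) (_ : CommRing T) (_ : CommRing B)
        (j : R →+* T) (β : T →+* B) (A : Subring B), IsGLRPullback j β A) ∧
    (∀ (T : Type v) (B : Type w) [CommRing T] [CommRing B]
        (j : R →+* T) (β : T →+* B) (A : Subring B),
        IsGLRPullback j β A → IsSemilocalRing T) :=
  ⟨⟨(mainTheorem4_general.{u, u, u} R).1, fun ⟨T, B, _, _, j, β, A, h⟩ =>
      ((mainTheorem4_general R).2 T B j β A h.isLocalNagataPullback).1⟩,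
    fun T B _ _ j β A h => ((mainTheorem4_general R).2 T B j β A h.isLocalNagataPullback).2⟩
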